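/- Let $Var$ be a countable set of propositional variables and let $\mathcal{L}_{\Box\Diamond}$ be the set of formulas built from $Var$ with $\bot,\wedge,\vee,\to,\Box,\Diamond$; put $\neg\varphi:=\varphi\to\bot$ and $\top:=\neg\bot$. A \emph{possibilistic Gödel frame} is a pair $\langle W,\pi\rangle$ with $W\neq\emptyset$ and $\pi:W\to[0,1]$ such that $\sup_{w\in W}\pi(w)=1$. A \emph{possibilistic Gödel model} $\langle W,\pi,e\rangle$ adds a map $e:W\times Var\to[0,1]$, extended to all formulas by $e(w,\bot)=0$, $e(w,\varphi\wedge\psi)=\min(e(w,\varphi),e(w,\psi))$, $e(w,\varphi\vee\psi)=\max(e(w,\varphi),e(w,\psi))$, $e(w,\varphi\to\psi)=e(w,\varphi)\Rightarrow e(w,\psi)$, $e(w,\Box\varphi)=\inf_{w'\in W}\{\pi(w')\Rightarrow e(w',\varphi)\}$ and $e(w,\Diamond\varphi)=\sup_{w'\in W}\min(\pi(w'),e(w',\varphi))$, where $x\Rightarrow y=1$ if $x\le y$ and $x\Rightarrow y=y$ otherwise. Write $T\models_{\Pi\mathcal{G}}\varphi$ if for every possibilistic Gödel model and every world $w$ of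 it, $e(w,\psi)=1$ for all $\psi\in T$ implies $e(w,\varphi)=1$. A formula is valid in a frame if it takes the value $1$ at every world of every model on that frame. The logic $KD45(\mathbf{G})$ has as axioms all instances of the axioms of propositional Gödel logic (intuitionistic logic plus prelinearity $(\varphi\to\psi)\vee(\psi\to\varphi)$) and of $\Box(\varphi\to\psi)\to(\Box\varphi\to\Box\psi)$, $\Diamond(\varphi\vee\psi)\to(\Diamond\varphi\vee\Diamond\psi)$, $\Box\top$, $\neg\Diamond\bot$, $\Box(\varphi\to\psi)\to(\Diamond\varphi\to\Diamond\psi)$, $(\Diamond\varphi\to\Box\psi)\to\Box(\varphi\to\psi)$, $\Diamond\top$, $\Box\varphi\to\Box\Box\varphi$, $\Diamond\Diamond\varphi\to\Diamond\varphi$, $\Diamond\Box\varphi\to\Box\varphi$, $\Diamond\varphi\to\Box\Diamond\varphi$, with the rules modus ponens and necessitation (from $\varphi$ infer $\Box\varphi$), where in derivations $T\vdash_{KD45(\mathbf{G})}\varphi$ from a theory $T$ necessitation is applied only to theorems, i.e. to formulas derivable from the empty theory. \textbf{Theorem (finite strong completeness).} For every finite set $T\subseteq\mathcal{L}_{\Box\Diamond}$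 and every $\varphi\in\mathcal{L}_{\Box\Diamond}$, $T\models_{\Pi\mathcal{G}}\varphi$ if and only if $T\vdash_{KD45(\mathbf{G})}\varphi$. In particular, the set of theorems of $KD45(\mathbf{G})$ is exactly the set of formulas valid in all possibilistic Gödel frames. -/

import Mathlib

universe u v

/-- Formulas of the bimodal language over a set `Var` of propositional variables. -/
inductive Formula (Var : Type u) : Type u where
  | var : Var → Formula Var
  | bot : Formula Var
  | and : Formula Var → Formula Var → Formula Var
  | or : Formula Var → Formula Var → Formula Var
  | imp : Formula Var → Formula Var → Formula Var
  | box : Formula Var → Formula Var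
  | dia : Formula Var → Formula Var

namespace Formula

variable {Var : Type u}

/-- Negation `¬φ` is `φ → ⊥`. -/
def neg (φ : Formula Var) : Formula Var := imp φ bot

/-- Verum `⊤` is `¬⊥`. -/
def top : Formula Var := neg bot

end Formula

open Formula in
/-- Axiom schemes of propositional Gödel logic: intuitionistic propositional logic together with
prelinearity, for arbitrary formulas of the bimodal language. -/
inductive GodelAxiom {Var : Type u} : Formula Var → Prop where
  | imp_weaken (φ ψ : Formula Var) : GodelAxiom (imp φ (imp ψ φ))
  | imp_distrib (φ ψ χ : Formula Var) :
      GodelAxiom (imp (imp φ (imp ψ χ)) (imp (imp φ ψ) (imp φ χ)))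
  | and_left (φ ψ : Formula Var) : GodelAxiom (imp (and φ ψ) φ)
  | and_right (φ ψ : Formula Var) : GodelAxiom (imp (and φ ψ) ψ)
  | and_intro (φ ψ : Formula Var) : GodelAxiom (imp φ (imp ψ (and φ ψ)))
  | or_left (φ ψ : Formula Var) : GodelAxiom (imp φ (or φ ψ))
  | or_right (φ ψ : Formula Var) : GodelAxiom (imp ψ (or φ ψ))
  | or_elim (φ ψ χ : Formula Var) :
      GodelAxiom (imp (imp φ χ) (imp (imp ψ χ) (imp (or φ ψ) χ)))
  | bot_elim (φ : Formula Var) : GodelAxiom (imp bot φ)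
  | prelinearity (φ ψ : Formula Var) : GodelAxiom (or (imp φ ψ) (imp ψ φ))

open Formula in
/-- Axiom schemes of `KD45(G)`. -/
inductive KD45GAxiom {Var : Type u} : Formula Var → Prop where
  | godel {φ : Formula Var} : GodelAxiom φ → KD45GAxiom φ
  | K_box (φ ψ : Formula Var) : KD45GAxiom (imp (box (imp φ ψ)) (imp (box φ) (box ψ)))
  | K_dia (φ ψ : Formula Var) : KD45GAxiom (imp (dia (or φ ψ)) (or (dia φ) (dia ψ)))
  | F_box : KD45GAxiom (box top)
  | F_dia : KD45GAxiom (neg (dia bot))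
  | P (φ ψ : Formula Var) : KD45GAxiom (imp (box (imp φ ψ)) (imp (dia φ) (dia ψ)))
  | FS2 (φ ψ : Formula Var) : KD45GAxiom (imp (imp (dia φ) (box ψ)) (box (imp φ ψ)))
  | D : KD45GAxiom (dia top)
  | four_box (φ : Formula Var) : KD45GAxiom (imp (box φ) (box (box φ)))
  | four_dia (φ : Formula Var) : KD45GAxiom (imp (dia (dia φ)) (dia φ))
  | five_box (φ : Formula Var) : KD45GAxiom (imp (dia (box φ)) (box φ))
  | five_dia (φ : Formula Var) : KD45GAxiom (imp (dia φ) (box (dia φ)))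

/-- `KD45GDerives T φ`: the formula `φ` is derivable from the theory `T` in `KD45(G)`, by
modus ponens and necessitation, the latter being applied to theorems (formulas derived without
hypotheses) only. -/
inductive KD45GDerives {Var : Type u} : Set (Formula Var) → Formula Var → Prop where
  | ax {T : Set (Formula Var)} {φ : Formula Var} : KD45GAxiom φ → KD45GDerives T φ
  | hyp {T : Set (Formula Var)} {φ : Formula Var} : φ ∈ T → KD45GDerives T φ
  | mp {T : Set (Formula Var)} {φ ψ : Formula Var} :
      KD45GDerives T (.imp φ ψ) → KD45GDerives T φ → KD45GDerives T ψ
  | nec {T : Set (Formula Var)} {φ : Formula Var} :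
      KD45GDerives ∅ φ → KD45GDerives T (.box φ)

/-- The theorems of `KD45(G)`. -/
def KD45GTheorems (Var : Type u) : Set (Formula Var) := {φ | KD45GDerives ∅ φ}

open Classical in
/-- Gödel implication on `[0,1]`. -/
noncomputable def godelImp (x y : unitInterval) : unitInterval := if x ≤ y then 1 else y

/-- A possibilistic Gödel frame: a non-empty set of worlds with a normalized possibility
distribution. -/
structure PossFrame where
  /-- the worlds -/
  W : Type v
  nonempty : Nonempty W
  /-- the possibility distribution -/
  poss : W → unitInterval
  normalized : ⨆ w, poss w = 1

namespace PossFrame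

variable {Var : Type u}

/-- The value of a formula at a world of a possibilistic Gödel model, that is, of a possibilistic
frame `F` together with an evaluation `e` of the variables in each world. -/
noncomputable def val (F : PossFrame.{v}) (e : F.W → Var → unitInterval) :
    Formula Var → F.W → unitInterval
  | .var p, w => e w p
  | .bot, _ => 0
  | .and φ ψ, w => min (F.val e φ w) (F.val e ψ w)
  | .or φ ψ, w => max (F.val e φ w) (F.val e ψ w)
  | .imp φ ψ, w => godelImp (F.val e φ w) (F.val e ψ w)
  | .box φ, _ => ⨅ w', godelImp (F.poss w') (F.val e φ w')
  | .dia φ, _ => ⨆ w', min (F.poss w') (F.val e φ w')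

/-- Validity of a formula in a frame: it takes the value `1` at every world of every model
based on the frame. -/
def Valid (F : PossFrame.{v}) (φ : Formula Var) : Prop :=
  ∀ (e : F.W → Var → unitInterval) (w : F.W), F.val e φ w = 1

end PossFrame

/-- Entailment over possibilistic Gödel models (with worlds in the universe `v`): in every world of
every model where all formulas of `T` take the value `1`, so does `φ`. -/
def PossEntails {Var : Type u} (T : Set (Formula Var)) (φ : Formula Var) : Prop :=
  ∀ (F : PossFrame.{v}) (e : F.W → Var → unitInterval) (w : F.W),
    (∀ ψ ∈ T, F.val e ψ w = 1) → F.val e φ w = 1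

/-- The set of formulas valid in all possibilistic Gödel frames (with worlds in the
universe `v`). -/
def PossValidities (Var : Type u) : Set (Formula Var) :=
  {φ | ∀ F : PossFrame.{v}, F.Valid φ}

/-! ### Gödel implication as a residuum -/

section GodelImplication

/-! Soundness is an induction on derivations. For completeness, a formula not derivable from `T` is
left out of some prime theory `V ⊇ T`, where prelinearity makes implication a linear preorder. On a
finite subformula-closed set `S` this preorder embeds into [0,1] by a map `g`, which is to be
realized at a world of possibility 0.

In a possibilistic model a modal formula has the same value at all worlds, and a world of
possibility `t` affects modal values only through its values cut off at `t`. A world is therefore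
taken to be a threshold `t` with a valuation `k` that equals `min g t` on modal formulas
(`IsLocalValuation`); its possibility may be 0, or `t` provided `k` satisfies □a ≤ a ≤ ◇a
(`IsAccessible`). The model consists of all such worlds. The truth lemma
`min_val_eq_of_isLocalValuation` needs only worlds approximating each □-infimum and ◇-supremum; no
world has to attain them.

These worlds come from prime theories `W` containing the modal part of `V`, a modal formula `γ`
whose value is the threshold, and all □b → b and b → ◇b. If these formulas derived `a`, then γ → □a
would lie in `V` (`IsPrimeTheory.imp_box_mem`). In `W` the modal formulas keep their order, except
that those above `γ` become true; `exists_order_extension` puts the other formulas into the gaps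
between modal values, as near to either end as desired. -/

theorem unitInterval_one_le_iff {x : unitInterval} : 1 ≤ x ↔ x = 1 :=
  ⟨fun h => le_antisymm unitInterval.le_one' h, fun h => h.ge⟩

/-- Residuation: it turns the validity of each axiom into an inequality between minima. -/
theorem le_godelImp {x y z : unitInterval} : z ≤ godelImp x y ↔ min z x ≤ y := by
  unfold godelImp
  split_ifs with h
  · simp only [unitInterval.le_one', true_iff]
    exact (min_le_right _ _).trans h
  · constructor
    · intro hz
      exact (min_le_left _ _).trans hz
    · intro hz
      rcases min_le_iff.1 hz with h' | h'
      · exact h'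
      · exact absurd h' h

theorem godelImp_eq_one {x y : unitInterval} : godelImp x y = 1 ↔ x ≤ y := by
  rw [← unitInterval_one_le_iff, le_godelImp, min_eq_right unitInterval.le_one']

theorem min_godelImp_le (x y : unitInterval) : min (godelImp x y) x ≤ y :=
  le_godelImp.1 le_rfl

end GodelImplication

/-! ### Soundness -/

section Soundness

variable {Var : Type u}

theorem GodelAxiom.val_eq_one {φ : Formula Var} (h : GodelAxiom φ) (F : PossFrame.{v})
    (e : F.W → Var → unitInterval) (w : F.W) : F.val e φ w = 1 := by
  cases h with
  | imp_weaken φ ψ =>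
    simp only [PossFrame.val, godelImp_eq_one, le_godelImp]
    exact min_le_left _ _
  | imp_distrib φ ψ χ =>
    simp only [PossFrame.val, godelImp_eq_one, le_godelImp]
    generalize F.val e φ w = a
    generalize F.val e ψ w = b
    generalize F.val e χ w = c
    have h1 := min_godelImp_le a (godelImp b c)
    have h2 := min_godelImp_le b c
    have h3 := min_godelImp_le a b
    have ha : min (min (godelImp a (godelImp b c)) (godelImp a b)) a ≤ godelImp b c :=
      le_trans (min_le_min_right _ (min_le_left _ _)) h1
    have hb : min (min (godelImp a (godelImp b c)) (godelImp a b)) a ≤ b :=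
      le_trans (min_le_min_right _ (min_le_right _ _)) h3
    exact (le_min ha hb).trans h2
  | and_left φ ψ =>
    simp only [PossFrame.val, godelImp_eq_one]
    exact min_le_left _ _
  | and_right φ ψ =>
    simp only [PossFrame.val, godelImp_eq_one]
    exact min_le_right _ _
  | and_intro φ ψ =>
    simp only [PossFrame.val, godelImp_eq_one, le_godelImp]
    exact le_rfl
  | or_left φ ψ =>
    simp only [PossFrame.val, godelImp_eq_one]
    exact le_max_left _ _
  | or_right φ ψ =>
    simp only [PossFrame.val, godelImp_eq_one]
    exact le_max_right _ _
  | or_elim φ ψ χ =>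
    simp only [PossFrame.val, godelImp_eq_one, le_godelImp]
    generalize F.val e φ w = a
    generalize F.val e ψ w = b
    generalize F.val e χ w = c
    rcases le_total a b with h | h
    · rw [max_eq_right h]
      exact le_trans (min_le_min_right _ (min_le_right _ _)) (min_godelImp_le b c)
    · rw [max_eq_left h]
      exact le_trans (min_le_min_right _ (min_le_left _ _)) (min_godelImp_le a c)
  | bot_elim φ =>
    simp only [PossFrame.val, godelImp_eq_one]
    exact unitInterval.nonneg'
  | prelinearity φ ψ =>
    simp only [PossFrame.val]
    rcases le_total (F.val e φ w) (F.val e ψ w) with h | h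
    · rw [godelImp_eq_one.2 h]
      exact max_eq_left unitInterval.le_one'
    · rw [godelImp_eq_one.2 h]
      exact max_eq_right unitInterval.le_one'

theorem PossFrame.le_val_box (F : PossFrame.{v}) (e : F.W → Var → unitInterval)
    {φ : Formula Var} {c : unitInterval} {w : F.W} :
    c ≤ F.val e (.box φ) w ↔ ∀ w', min c (F.poss w') ≤ F.val e φ w' := by
  simp only [PossFrame.val, le_iInf_iff, le_godelImp]

theorem PossFrame.val_dia_le (F : PossFrame.{v}) (e : F.W → Var → unitInterval)
    {φ : Formula Var} {c : unitInterval} {w : F.W} :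
    F.val e (.dia φ) w ≤ c ↔ ∀ w', min (F.poss w') (F.val e φ w') ≤ c := by
  simp only [PossFrame.val, iSup_le_iff]

/-- Meets distribute over suprema because `min b` has a right adjoint, the Gödel implication. -/
theorem PossFrame.min_val_dia_le (F : PossFrame.{v}) (e : F.W → Var → unitInterval)
    {φ : Formula Var} {b c : unitInterval} {w : F.W} :
    min b (F.val e (.dia φ) w) ≤ c ↔ ∀ w', min b (min (F.poss w') (F.val e φ w')) ≤ c := by
  rw [min_comm, ← le_godelImp, F.val_dia_le]
  simp only [le_godelImp, min_comm b]

theorem KD45GAxiom.val_eq_one {φ : Formula Var} (h : KD45GAxiom φ) (F : PossFrame.{v})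
    (e : F.W → Var → unitInterval) (w : F.W) : F.val e φ w = 1 := by
  cases h with
  | godel h => exact h.val_eq_one F e w
  | K_box φ ψ =>
    rw [PossFrame.val, godelImp_eq_one, PossFrame.val, le_godelImp, F.le_val_box]
    intro w'
    have h1 := (F.le_val_box e (w := w)).1 (le_refl (F.val e (.box (φ.imp ψ)) w)) w'
    have h2 := (F.le_val_box e (w := w)).1 (le_refl (F.val e (.box φ) w)) w'
    rw [PossFrame.val, le_godelImp] at h1
    refine le_trans (le_min (le_min ?_ ?_) (le_trans ?_ h2)) h1
    · exact (min_le_left _ _).trans (min_le_left _ _)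
    · exact min_le_right _ _
    · exact min_le_min_right _ (min_le_right _ _)
  | K_dia φ ψ =>
    rw [PossFrame.val, godelImp_eq_one, F.val_dia_le]
    intro w'
    have h1 := (F.val_dia_le e (w := w)).1 (le_refl (F.val e (.dia φ) w)) w'
    have h2 := (F.val_dia_le e (w := w)).1 (le_refl (F.val e (.dia ψ) w)) w'
    rw [PossFrame.val, PossFrame.val, min_max_distrib_left]
    exact max_le_max h1 h2
  | F_box =>
    rw [← unitInterval_one_le_iff, F.le_val_box]
    intro w'
    rw [Formula.top, Formula.neg, PossFrame.val, godelImp_eq_one.2 le_rfl]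
    exact unitInterval.le_one'
  | F_dia =>
    rw [Formula.neg, PossFrame.val, godelImp_eq_one, F.val_dia_le]
    intro w'
    exact min_le_right _ _
  | P φ ψ =>
    rw [PossFrame.val, godelImp_eq_one, PossFrame.val, le_godelImp, F.min_val_dia_le]
    intro w'
    have h1 := (F.le_val_box e (w := w)).1 (le_refl (F.val e (.box (φ.imp ψ)) w)) w'
    have h2 := (F.val_dia_le e (w := w)).1 (le_refl (F.val e (.dia ψ) w)) w'
    rw [PossFrame.val, le_godelImp, min_assoc] at h1
    exact le_trans (le_min ((min_le_right _ _).trans (min_le_left _ _)) h1) h2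
  | FS2 φ ψ =>
    rw [PossFrame.val, godelImp_eq_one, F.le_val_box]
    intro w'
    rw [PossFrame.val, PossFrame.val, le_godelImp]
    have h1 := (F.val_dia_le e (w := w)).1 (le_refl (F.val e (.dia φ) w)) w'
    have h2 := (F.le_val_box e (w := w)).1 (le_refl (F.val e (.box ψ) w)) w'
    have h3 := min_godelImp_le (F.val e (.dia φ) w) (F.val e (.box ψ) w)
    refine le_trans (le_min (le_trans (le_min ?_ (le_trans ?_ h1)) h3) ?_) h2
    · exact (min_le_left _ _).trans (min_le_left _ _)
    · exact min_le_min_right _ (min_le_right _ _)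
    · exact (min_le_left _ _).trans (min_le_right _ _)
  | D =>
    rw [PossFrame.val, ← F.normalized]
    congr 1
    funext w'
    rw [Formula.top, Formula.neg, PossFrame.val, godelImp_eq_one.2 le_rfl]
    exact min_eq_left unitInterval.le_one'
  | four_box φ =>
    rw [PossFrame.val, godelImp_eq_one, F.le_val_box]
    intro w'
    exact min_le_left _ _
  | four_dia φ =>
    rw [PossFrame.val, godelImp_eq_one, F.val_dia_le]
    intro w'
    exact min_le_right _ _
  | five_box φ =>
    rw [PossFrame.val, godelImp_eq_one, F.val_dia_le]
    intro w'
    exact min_le_right _ _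
  | five_dia φ =>
    rw [PossFrame.val, godelImp_eq_one, F.le_val_box]
    intro w'
    exact min_le_left _ _

theorem KD45GDerives.sound {T : Set (Formula Var)} {φ : Formula Var} (h : KD45GDerives T φ) :
    PossEntails.{u, v} T φ := by
  induction h with
  | ax h => exact fun F e w _ => h.val_eq_one F e w
  | hyp h => exact fun F e w hT => hT _ h
  | mp _ _ ih1 ih2 =>
    intro F e w hT
    have h1 := ih1 F e w hT
    rw [PossFrame.val, godelImp_eq_one, ih2 F e w hT] at h1
    exact unitInterval_one_le_iff.1 h1
  -- The premise has no hypotheses, so the induction hypothesis applies at every world.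
  | nec _ ih =>
    intro F e w _
    rw [← unitInterval_one_le_iff, F.le_val_box]
    intro w'
    rw [ih F e w' (by simp)]
    exact unitInterval.le_one'

end Soundness

/-! ### Derivations, modal formulas and prime theories -/

section Derivations

variable {Var : Type u} {T : Set (Formula Var)} {φ ψ χ : Formula Var}

open Formula

namespace KD45GDerives

theorem mono {T' : Set (Formula Var)} (h : KD45GDerives T φ) (hT : T ⊆ T') :
    KD45GDerives T' φ := by
  induction h with
  | ax h => exact .ax h
  | hyp h => exact .hyp (hT h)
  | mp _ _ ih1 ih2 => exact .mp (ih1 hT) (ih2 hT)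
  | nec h _ => exact .nec h

theorem godel (h : GodelAxiom φ) : KD45GDerives T φ := .ax (.godel h)

theorem weaken (h : KD45GDerives T φ) : KD45GDerives T (imp ψ φ) :=
  .mp (godel (.imp_weaken φ ψ)) h

theorem imp_self (φ : Formula Var) : KD45GDerives T (imp φ φ) :=
  .mp (.mp (godel (.imp_distrib φ (imp φ φ) φ)) (godel (.imp_weaken φ (imp φ φ))))
    (godel (.imp_weaken φ φ))

/-- Necessitation causes no trouble: a necessitated formula comes from a theorem, so it does not
depend on the discharged hypothesis. -/
theorem deduction (h : KD45GDerives (insert φ T) ψ) : KD45GDerives T (imp φ ψ) := by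
  generalize hT' : insert φ T = T' at h
  induction h with
  | ax h => exact weaken (.ax h)
  | hyp h =>
    subst hT'
    rcases h with rfl | h
    · exact imp_self _
    · exact weaken (.hyp h)
  | mp _ _ ih1 ih2 => exact .mp (.mp (godel (.imp_distrib _ _ _)) (ih1 hT')) (ih2 hT')
  | nec h _ => exact weaken (.nec h)

theorem hyp_insert : KD45GDerives (insert φ T) φ := .hyp (Set.mem_insert _ _)

theorem insert_of (h : KD45GDerives T φ) : KD45GDerives (insert ψ T) φ :=
  h.mono (Set.subset_insert _ _)

theorem imp_trans (h1 : KD45GDerives T (imp φ ψ)) (h2 : KD45GDerives T (imp ψ χ)) :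
    KD45GDerives T (imp φ χ) :=
  deduction (.mp h2.insert_of (.mp h1.insert_of hyp_insert))

theorem top : KD45GDerives T (Formula.top : Formula Var) := imp_self _

theorem bot_elim (h : KD45GDerives T (bot : Formula Var)) : KD45GDerives T φ :=
  .mp (godel (.bot_elim _)) h

/-- If every formula of `P` is necessitated by `Y`, then so is every consequence of `P`. -/
theorem box_of_forall {P Y : Set (Formula Var)} (h : KD45GDerives P φ)
    (hP : ∀ p ∈ P, KD45GDerives Y (box p)) : KD45GDerives Y (box φ) := by
  induction h with
  | ax h => exact .nec (.ax h)
  | hyp h => exact hP _ h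
  | mp _ _ ih1 ih2 => exact .mp (.mp (.ax (.K_box _ _)) (ih1 hP)) (ih2 hP)
  | nec h _ => exact .nec (.nec h)

theorem dia_mono (h : KD45GDerives T (box (imp φ ψ))) : KD45GDerives T (imp (dia φ) (dia ψ)) :=
  .mp (.ax (.P _ _)) h

/-- `FS2` converts the two 5-axioms into reflexivity principles under □; these make witness worlds
accessible. -/
theorem box_box_imp (φ : Formula Var) : KD45GDerives T (box (imp (box φ) φ)) :=
  .mp (.ax (.FS2 _ _)) (.ax (.five_box φ))

theorem box_imp_dia (φ : Formula Var) : KD45GDerives T (box (imp φ (dia φ))) :=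
  .mp (.ax (.FS2 _ _)) (.ax (.five_dia φ))

theorem exists_of_sUnion {c : Set (Set (Formula Var))} (hc : IsChain (· ⊆ ·) c)
    (hne : c.Nonempty) (h : KD45GDerives (⋃₀ c) φ) : ∃ T ∈ c, KD45GDerives T φ := by
  generalize hT' : ⋃₀ c = T' at h
  induction h with
  | ax h => exact ⟨_, hne.some_mem, .ax h⟩
  | hyp h =>
    subst hT'
    obtain ⟨T, hT, h⟩ := h
    exact ⟨T, hT, .hyp h⟩
  | mp _ _ ih1 ih2 =>
    obtain ⟨T1, hT1, h1⟩ := ih1 hT'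
    obtain ⟨T2, hT2, h2⟩ := ih2 hT'
    rcases hc.total hT1 hT2 with h | h
    · exact ⟨T2, hT2, .mp (h1.mono h) h2⟩
    · exact ⟨T1, hT1, .mp h1 (h2.mono h)⟩
  | nec h _ => exact ⟨_, hne.some_mem, .nec h⟩

end KD45GDerives

/-- Formulas in which every variable is in the scope of a modality. -/
inductive Formula.IsModal : Formula Var → Prop
  | bot : IsModal bot
  | box (φ : Formula Var) : IsModal (box φ)
  | dia (φ : Formula Var) : IsModal (dia φ)
  | imp {φ ψ : Formula Var} : IsModal φ → IsModal ψ → IsModal (imp φ ψ)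

theorem Formula.IsModal.top : IsModal (Formula.top : Formula Var) := .imp .bot .bot

/-- Modal formulas act as constants: □ and ◇ do not change their truth. Closure under implication
matters because implications record the order of truth values. -/
theorem Formula.IsModal.derives (h : IsModal φ) : ∀ {T : Set (Formula Var)},
    KD45GDerives T (Formula.imp φ (Formula.box φ)) ∧
      KD45GDerives T (Formula.imp (Formula.dia φ) φ) := by
  induction h with
  | bot => exact ⟨.godel (.bot_elim _), .ax .F_dia⟩
  | box φ => exact ⟨.ax (.four_box φ), .ax (.five_box φ)⟩
  | dia φ => exact ⟨.ax (.five_dia φ), .ax (.four_dia φ)⟩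
  | @imp a b _ _ ih1 ih2 =>
    intro T
    constructor
    · refine .deduction (.mp (.ax (.FS2 _ _)) (.deduction ?_))
      exact .mp ih2.1 (.mp (KD45GDerives.hyp_insert.insert_of) (.mp ih1.2 .hyp_insert))
    · refine .deduction (.deduction (.mp ih2.2 ?_))
      -- From a follows □a, hence □((a → b) → b), so ◇(a → b) gives ◇b and then b.
      refine .mp (.dia_mono ?_) (KD45GDerives.hyp_insert.insert_of)
      refine KD45GDerives.box_of_forall (P := {a}) (.deduction ?_) (fun p hp => ?_)
      · exact .mp .hyp_insert (.insert_of (.hyp rfl))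
      · rw [Set.mem_singleton_iff] at hp
        subst hp
        exact .mp ih1.1 .hyp_insert

/-- Prime theories: deductively closed sets of formulas with the disjunction property. -/
structure IsPrimeTheory (X : Set (Formula Var)) : Prop where
  mem_of_derives : ∀ {φ}, KD45GDerives X φ → φ ∈ X
  mem_or_mem : ∀ {φ ψ}, Formula.or φ ψ ∈ X → φ ∈ X ∨ ψ ∈ X

/-- A set maximal among those not deriving φ is prime: by the deduction theorem every formula
outside it implies φ. -/
theorem exists_isPrimeTheory (h : ¬ KD45GDerives T φ) :
    ∃ X, T ⊆ X ∧ IsPrimeTheory X ∧ φ ∉ X := by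
  obtain ⟨X, hTX, hX⟩ := zorn_subset_nonempty {X : Set (Formula Var) | ¬ KD45GDerives X φ}
    (fun c hc hchain hne => ⟨⋃₀ c, fun hd => by
      obtain ⟨Y, hY, hd⟩ := KD45GDerives.exists_of_sUnion hchain hne hd
      exact hc hY hd, fun s hs => Set.subset_sUnion_of_mem hs⟩) T h
  have key : ∀ {ψ}, ψ ∉ X → KD45GDerives X (imp ψ φ) := by
    intro ψ hψ
    refine .deduction ?_
    by_contra hcon
    exact hψ (hX.le_of_ge hcon (Set.subset_insert _ _) (Set.mem_insert _ _))
  refine ⟨X, hTX, ⟨?_, ?_⟩, fun hφ => hX.prop (.hyp hφ)⟩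
  · intro ψ hψ
    by_contra hcon
    exact hX.prop (.mp (key hcon) hψ)
  · intro ψ χ hor
    by_contra! hcon
    exact hX.prop (.mp (.mp (.mp (.godel (.or_elim _ _ _)) (key hcon.1)) (key hcon.2)) (.hyp hor))

namespace IsPrimeTheory

variable {X : Set (Formula Var)}

theorem mp (hX : IsPrimeTheory X) (h1 : imp φ ψ ∈ X) (h2 : φ ∈ X) : ψ ∈ X :=
  hX.mem_of_derives (.mp (.hyp h1) (.hyp h2))

theorem imp_total (hX : IsPrimeTheory X) (φ ψ : Formula Var) : imp φ ψ ∈ X ∨ imp ψ φ ∈ X :=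
  hX.mem_or_mem (hX.mem_of_derives (.godel (.prelinearity _ _)))

theorem imp_trans (hX : IsPrimeTheory X) (h1 : imp φ ψ ∈ X) (h2 : imp ψ χ ∈ X) :
    imp φ χ ∈ X :=
  hX.mem_of_derives (.imp_trans (.hyp h1) (.hyp h2))

theorem imp_of_mem (hX : IsPrimeTheory X) (h : ψ ∈ X) : imp φ ψ ∈ X :=
  hX.mem_of_derives (.weaken (.hyp h))

theorem top_imp_mem_iff (hX : IsPrimeTheory X) : imp Formula.top φ ∈ X ↔ φ ∈ X :=
  ⟨fun h => hX.mp h (hX.mem_of_derives .top), hX.imp_of_mem⟩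

/-- In a linear order of truth values, an implication that is not true is below its conclusion. -/
theorem imp_imp_self (hX : IsPrimeTheory X) (h : imp φ ψ ∉ X) :
    imp (imp φ ψ) ψ ∈ X := by
  -- Prelinearity is applied to φ and φ → ψ; the first alternative contracts to φ → ψ.
  rcases hX.imp_total φ (imp φ ψ) with h1 | h1
  · exact absurd (hX.mem_of_derives (.deduction
      (.mp (.mp (.insert_of (.hyp h1)) .hyp_insert) .hyp_insert))) h
  · exact hX.mem_of_derives (.deduction
      (.mp .hyp_insert (.mp (.insert_of (.hyp h1)) .hyp_insert)))

end IsPrimeTheory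

end Derivations

/-! ### Extending order embeddings of finite linear preorders -/

section OrderExtension

variable {α : Type u} {le : α → α → Prop} {S M : Set α}

/-- The rank counts the elements of `S` below the point, scaled into [0,1]. -/
theorem exists_rank (total : ∀ a b, le a b ∨ le b a) (trans : ∀ {a b c}, le a b → le b c → le a c)
    (hS : S.Finite) : ∃ r : α → ℝ, (∀ a, 0 ≤ r a) ∧ (∀ a, r a ≤ 1) ∧
      (∀ a b, le a b → r a ≤ r b) ∧ ∀ a ∈ S, ∀ b ∈ S, ¬ le b a → r a < r b := by
  have hfin : ∀ a, {c ∈ S | le c a}.Finite := fun a => hS.subset (Set.sep_subset _ _)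
  have hpos : (0 : ℝ) < S.ncard + 1 := by positivity
  refine ⟨fun a => {c ∈ S | le c a}.ncard / (S.ncard + 1), fun a => by positivity, fun a => ?_,
    fun a b hab => ?_, fun a _ b hb hba => ?_⟩
  · rw [div_le_one hpos]
    have : {c ∈ S | le c a}.ncard ≤ S.ncard := Set.ncard_le_ncard (Set.sep_subset _ _) hS
    exact_mod_cast this.trans (Nat.le_succ _)
  · have : {c ∈ S | le c a}.ncard ≤ {c ∈ S | le c b}.ncard :=
      Set.ncard_le_ncard (fun c hc => ⟨hc.1, trans hc.2 hab⟩) (hfin b)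
    simp only
    gcongr
  · have hab : le a b := (total a b).resolve_right hba
    have : {c ∈ S | le c a}.ncard < {c ∈ S | le c b}.ncard :=
      Set.ncard_lt_ncard ⟨fun c hc => ⟨hc.1, trans hc.2 hab⟩,
        fun h => hba (h ⟨hb, (total b b).elim id id⟩).2⟩ (hfin b)
    simp only
    gcongr

/-- An order embedding of a part `M` of a finite linear preorder `S` into the reals extends to `S`,
where the new points divide the gaps of `M` in ratios within a prescribed interval `[p, q]`. -/
theorem exists_order_extension (total : ∀ a b, le a b ∨ le b a)
    (trans : ∀ {a b c}, le a b → le b c → le a c) (hS : S.Finite) (hMS : M ⊆ S) {g : α → ℝ}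
    (hg : ∀ a ∈ M, ∀ b ∈ M, g a ≤ g b ↔ le a b) (hlo : ∀ a ∈ S, ∃ m ∈ M, le m a)
    (hhi : ∀ a ∈ S, ∃ m ∈ M, le a m) {p q : ℝ} (hp : 0 ≤ p) (hpq : p < q) (hq : q ≤ 1) :
    ∃ k : α → ℝ, (∀ a ∈ M, k a = g a) ∧ (∀ a ∈ S, ∀ b ∈ S, k a ≤ k b ↔ le a b) ∧
      ∀ a ∈ S, ∃ m ∈ M, ∃ m' ∈ M, le m a ∧ le a m' ∧
        g m + p * (g m' - g m) ≤ k a ∧ k a ≤ g m + q * (g m' - g m) := by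
  have refl : ∀ a, le a a := fun a => (total a a).elim id id
  have hM : M.Finite := hS.subset hMS
  -- `L a` and `H a` are the ends of the gap of `M` around `a`; `a` is placed at the fraction `p +
  -- (q - p) * r a` of this gap.
  have hL : ∀ a, ∃ m, a ∈ S → m ∈ M ∧ le m a ∧ ∀ m' ∈ M, le m' a → g m' ≤ g m := by
    intro a
    by_cases ha : a ∈ S
    · obtain ⟨m, hm, hmax⟩ := Set.exists_max_image {m ∈ M | le m a} g
        (hM.subset (Set.sep_subset _ _)) (hlo a ha)
      exact ⟨m, fun _ => ⟨hm.1, hm.2, fun m' h1 h2 => hmax m' ⟨h1, h2⟩⟩⟩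
    · exact ⟨a, fun h => absurd h ha⟩
  have hH : ∀ a, ∃ m, a ∈ S → m ∈ M ∧ le a m ∧ ∀ m' ∈ M, le a m' → g m ≤ g m' := by
    intro a
    by_cases ha : a ∈ S
    · obtain ⟨m, hm, hmin⟩ := Set.exists_min_image {m ∈ M | le a m} g
        (hM.subset (Set.sep_subset _ _)) (hhi a ha)
      exact ⟨m, fun _ => ⟨hm.1, hm.2, fun m' h1 h2 => hmin m' ⟨h1, h2⟩⟩⟩
    · exact ⟨a, fun h => absurd h ha⟩
  choose L hL using hL
  choose H hH using hH
  obtain ⟨r, hr0, hr1, hrmono, hrstrict⟩ := exists_rank total trans hS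
  have hLH : ∀ a ∈ S, g (L a) ≤ g (H a) := fun a ha =>
    (hg _ (hL a ha).1 _ (hH a ha).1).2 (trans (hL a ha).2.1 (hH a ha).2.1)
  have hs0 : ∀ a, p ≤ p + (q - p) * r a := fun a => by
    have := mul_nonneg (sub_nonneg.2 hpq.le) (hr0 a)
    linarith
  have hs1 : ∀ a, p + (q - p) * r a ≤ q := fun a => by
    have := mul_le_mul_of_nonneg_left (hr1 a) (sub_nonneg.2 hpq.le)
    linarith
  have hsmono : ∀ a b, le a b → p + (q - p) * r a ≤ p + (q - p) * r b := fun a b hab => by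
    have := mul_le_mul_of_nonneg_left (hrmono a b hab) (sub_nonneg.2 hpq.le)
    linarith
  have hsstrict : ∀ a ∈ S, ∀ b ∈ S, ¬ le b a → p + (q - p) * r a < p + (q - p) * r b :=
    fun a ha b hb hab => by
      have := mul_lt_mul_of_pos_left (hrstrict a ha b hb hab) (sub_pos.2 hpq)
      linarith
  generalize hs : (fun a => p + (q - p) * r a) = s at *
  replace hs0 : ∀ a, p ≤ s a := by subst hs; exact hs0
  replace hs1 : ∀ a, s a ≤ q := by subst hs; exact hs1
  replace hsmono : ∀ a b, le a b → s a ≤ s b := by subst hs; exact hsmono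
  replace hsstrict : ∀ a ∈ S, ∀ b ∈ S, ¬ le b a → s a < s b := by subst hs; exact hsstrict
  clear hs
  have hmono : ∀ a ∈ S, ∀ b ∈ S, le a b →
      g (L a) + s a * (g (H a) - g (L a)) ≤ g (L b) + s b * (g (H b) - g (L b)) := by
    intro a ha b hb hab
    have h1 : g (L a) ≤ g (L b) := (hL b hb).2.2 _ (hL a ha).1 (trans (hL a ha).2.1 hab)
    have h2 : g (H a) ≤ g (H b) := (hH a ha).2.2 _ (hH b hb).1 (trans hab (hH b hb).2.1)
    -- The difference is (s b − s a)(g (H b) − g (L b)) + s a (g (H b) − g (H a)) + (1 − s a)(g (L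
    -- b) − g (L a)).
    nlinarith [hs0 a, hs1 a, hsmono a b hab, hLH b hb,
      mul_nonneg (sub_nonneg.2 (hsmono a b hab)) (sub_nonneg.2 (hLH b hb)),
      mul_nonneg (hp.trans (hs0 a)) (sub_nonneg.2 h2),
      mul_nonneg (sub_nonneg.2 ((hs1 a).trans hq)) (sub_nonneg.2 h1)]
  have hstrict : ∀ a ∈ S, ∀ b ∈ S, ¬ le b a →
      g (L a) + s a * (g (H a) - g (L a)) < g (L b) + s b * (g (H b) - g (L b)) := by
    intro a ha b hb hba
    have hab : le a b := (total a b).resolve_right hba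
    have h1 : g (L a) ≤ g (L b) := (hL b hb).2.2 _ (hL a ha).1 (trans (hL a ha).2.1 hab)
    have h2 : g (H a) ≤ g (H b) := (hH a ha).2.2 _ (hH b hb).1 (trans hab (hH b hb).2.1)
    have h3 : g (L a) < g (H b) := by
      by_contra! hcon
      exact hba (trans (hH b hb).2.1 (trans ((hg _ (hH b hb).1 _ (hL a ha).1).1 hcon)
        (hL a ha).2.1))
    have hlt := hsstrict a ha b hb hba
    have hsa := hp.trans (hs0 a)
    have hsb := (hs1 b).trans hq
    -- If either gap is nondegenerate, the difference of ranks gives strictness; otherwise `h3`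
    -- does.
    rcases (hLH b hb).lt_or_eq with hb' | hb'
    · nlinarith [mul_pos (sub_pos.2 hlt) (sub_pos.2 hb'),
        mul_nonneg hsa (sub_nonneg.2 h2),
        mul_nonneg (sub_nonneg.2 (hlt.le.trans hsb)) (sub_nonneg.2 h1)]
    · rcases (hLH a ha).lt_or_eq with ha' | ha'
      · nlinarith [mul_pos (sub_pos.2 hlt) (sub_pos.2 ha'),
          mul_nonneg (hsa.trans hlt.le) (sub_nonneg.2 h2),
          mul_nonneg (sub_nonneg.2 hsb) (sub_nonneg.2 h1)]
      · rw [ha', hb', sub_self, sub_self, mul_zero, mul_zero, add_zero, add_zero, ← ha']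
        exact h3
  refine ⟨fun a => g (L a) + s a * (g (H a) - g (L a)), fun a ha => ?_, fun a ha b hb =>
    ⟨fun h => ?_, hmono a ha b hb⟩, fun a ha => ⟨L a, (hL a ha).1, H a, (hH a ha).1,
      (hL a ha).2.1, (hH a ha).2.1, ?_, ?_⟩⟩
  · have haS := hMS ha
    have h1 : g (L a) = g a := le_antisymm ((hg _ (hL a haS).1 _ ha).2 (hL a haS).2.1)
      ((hL a haS).2.2 a ha (refl a))
    have h2 : g (H a) = g a := le_antisymm ((hH a haS).2.2 a ha (refl a))
      ((hg _ ha _ (hH a haS).1).2 (hH a haS).2.1)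
    simp only [h1, h2, sub_self, mul_zero, add_zero]
  · by_contra hcon
    exact absurd h (not_le.2 (hstrict b hb a ha hcon))
  · have := mul_le_mul_of_nonneg_right (hs0 a) (sub_nonneg.2 (hLH a ha))
    simp only
    linarith
  · have := mul_le_mul_of_nonneg_right (hs1 a) (sub_nonneg.2 (hLH a ha))
    simp only
    linarith

/-- The version of `exists_order_extension` for maps into the unit interval. -/
theorem exists_unitInterval_order_extension (total : ∀ a b, le a b ∨ le b a)
    (trans : ∀ {a b c}, le a b → le b c → le a c) (hS : S.Finite) (hMS : M ⊆ S)
    {g : α → unitInterval}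
    (hg : ∀ a ∈ M, ∀ b ∈ M, g a ≤ g b ↔ le a b) (hlo : ∀ a ∈ S, ∃ m ∈ M, le m a)
    (hhi : ∀ a ∈ S, ∃ m ∈ M, le a m) {p q : ℝ} (hp : 0 ≤ p) (hpq : p < q) (hq : q ≤ 1) :
    ∃ k : α → unitInterval, (∀ a ∈ M, k a = g a) ∧ (∀ a ∈ S, ∀ b ∈ S, k a ≤ k b ↔ le a b) ∧
      ∀ a ∈ S, (∃ m ∈ M, le m a ∧ (k a : ℝ) ≤ g m + q) ∧
        ∃ m ∈ M, le a m ∧ (g m : ℝ) - (1 - p) ≤ k a := by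
  obtain ⟨k, hk1, hk2, hk3⟩ := exists_order_extension total trans hS hMS
    (g := fun a => (g a : ℝ)) hg hlo hhi hp hpq hq
  have hmem : ∀ a ∈ S, k a ∈ unitInterval := by
    intro a ha
    obtain ⟨m, hm, m', hm', h1, h2, h3, h4⟩ := hk3 a ha
    have hle : (g m : ℝ) ≤ g m' := (hg m hm m' hm').2 (trans h1 h2)
    constructor
    · refine le_trans ?_ h3
      exact add_nonneg (g m).2.1 (mul_nonneg hp (sub_nonneg.2 hle))
    · refine h4.trans ?_
      nlinarith [(g m').2.2, mul_nonneg (sub_nonneg.2 hq) (sub_nonneg.2 hle)]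
  have hproj : ∀ a ∈ S, ((Set.projIcc 0 1 zero_le_one (k a) : unitInterval) : ℝ) = k a := by
    intro a ha
    rw [Set.projIcc_of_mem _ (hmem a ha)]
  refine ⟨fun a => Set.projIcc 0 1 zero_le_one (k a), fun a ha => ?_, fun a ha b hb => ?_,
    fun a ha => ?_⟩
  · exact Subtype.ext ((hproj a (hMS ha)).trans (hk1 a ha))
  · rw [← Subtype.coe_le_coe, hproj a ha, hproj b hb]
    exact hk2 a ha b hb
  · obtain ⟨m, hm, m', hm', h1, h2, h3, h4⟩ := hk3 a ha
    simp only [hproj a ha]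
    have hle : (g m : ℝ) ≤ g m' := (hg m hm m' hm').2 (trans h1 h2)
    refine ⟨⟨m, hm, h1, h4.trans ?_⟩, m', hm', h2, le_trans ?_ h3⟩
    · nlinarith [(g m').2.2, (g m).2.1, hp.trans hpq.le]
    · nlinarith [(g m').2.2, (g m).2.1, hp.trans hpq.le]

end OrderExtension

/-! ### Finite subformula-closed sets -/

section SubformulaClosed

variable {Var : Type u}

open Formula

/-- Sets of formulas closed under subformulas. -/
structure IsSubformulaClosed (S : Set (Formula Var)) : Prop where
  and : ∀ {a b}, Formula.and a b ∈ S → a ∈ S ∧ b ∈ S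
  or : ∀ {a b}, Formula.or a b ∈ S → a ∈ S ∧ b ∈ S
  imp : ∀ {a b}, Formula.imp a b ∈ S → a ∈ S ∧ b ∈ S
  box : ∀ {a}, Formula.box a ∈ S → a ∈ S
  dia : ∀ {a}, Formula.dia a ∈ S → a ∈ S

theorem IsSubformulaClosed.union {S S' : Set (Formula Var)} (hS : IsSubformulaClosed S)
    (hS' : IsSubformulaClosed S') : IsSubformulaClosed (S ∪ S') where
  and h := h.elim (fun h => ⟨.inl (hS.and h).1, .inl (hS.and h).2⟩)
    fun h => ⟨.inr (hS'.and h).1, .inr (hS'.and h).2⟩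
  or h := h.elim (fun h => ⟨.inl (hS.or h).1, .inl (hS.or h).2⟩)
    fun h => ⟨.inr (hS'.or h).1, .inr (hS'.or h).2⟩
  imp h := h.elim (fun h => ⟨.inl (hS.imp h).1, .inl (hS.imp h).2⟩)
    fun h => ⟨.inr (hS'.imp h).1, .inr (hS'.imp h).2⟩
  box h := h.elim (fun h => .inl (hS.box h)) fun h => .inr (hS'.box h)
  dia h := h.elim (fun h => .inl (hS.dia h)) fun h => .inr (hS'.dia h)

theorem exists_finite_isSubformulaClosed (φ : Formula Var) :
    ∃ S : Set (Formula Var), S.Finite ∧ IsSubformulaClosed S ∧ φ ∈ S := by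
  have binary : ∀ (c : Formula Var) {a b : Formula Var}
      (_ : ∀ S, IsSubformulaClosed S → a ∈ S → b ∈ S → IsSubformulaClosed (insert c S)),
      (∃ S, S.Finite ∧ IsSubformulaClosed S ∧ a ∈ S) →
      (∃ S, S.Finite ∧ IsSubformulaClosed S ∧ b ∈ S) →
      ∃ S, S.Finite ∧ IsSubformulaClosed S ∧ c ∈ S := by
    rintro c a b h ⟨S, hSf, hS, ha⟩ ⟨S', hSf', hS', hb⟩
    exact ⟨insert c (S ∪ S'), (hSf.union hSf').insert c, h _ (hS.union hS') (.inl ha) (.inr hb),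
      Set.mem_insert _ _⟩
  induction φ with
  | var p => exact ⟨{var p}, Set.finite_singleton _, by constructor <;> simp, rfl⟩
  | bot => exact ⟨{bot}, Set.finite_singleton _, by constructor <;> simp, rfl⟩
  | and a b iha ihb =>
    refine binary _ (fun S hS ha hb => ?_) iha ihb
    constructor
    all_goals simp only [Set.mem_insert_iff, reduceCtorEq, false_or, Formula.and.injEq]
    · rintro a' b' (⟨rfl, rfl⟩ | h)
      exacts [⟨.inr ha, .inr hb⟩, ⟨.inr (hS.and h).1, .inr (hS.and h).2⟩]
    · exact fun h => ⟨.inr (hS.or h).1, .inr (hS.or h).2⟩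
    · exact fun h => ⟨.inr (hS.imp h).1, .inr (hS.imp h).2⟩
    · exact fun h => .inr (hS.box h)
    · exact fun h => .inr (hS.dia h)
  | or a b iha ihb =>
    refine binary _ (fun S hS ha hb => ?_) iha ihb
    constructor
    all_goals simp only [Set.mem_insert_iff, reduceCtorEq, false_or, Formula.or.injEq]
    · exact fun h => ⟨.inr (hS.and h).1, .inr (hS.and h).2⟩
    · rintro a' b' (⟨rfl, rfl⟩ | h)
      exacts [⟨.inr ha, .inr hb⟩, ⟨.inr (hS.or h).1, .inr (hS.or h).2⟩]
    · exact fun h => ⟨.inr (hS.imp h).1, .inr (hS.imp h).2⟩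
    · exact fun h => .inr (hS.box h)
    · exact fun h => .inr (hS.dia h)
  | imp a b iha ihb =>
    refine binary _ (fun S hS ha hb => ?_) iha ihb
    constructor
    all_goals simp only [Set.mem_insert_iff, reduceCtorEq, false_or, Formula.imp.injEq]
    · exact fun h => ⟨.inr (hS.and h).1, .inr (hS.and h).2⟩
    · exact fun h => ⟨.inr (hS.or h).1, .inr (hS.or h).2⟩
    · rintro a' b' (⟨rfl, rfl⟩ | h)
      exacts [⟨.inr ha, .inr hb⟩, ⟨.inr (hS.imp h).1, .inr (hS.imp h).2⟩]
    · exact fun h => .inr (hS.box h)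
    · exact fun h => .inr (hS.dia h)
  | box a iha =>
    refine binary _ (fun S hS ha _ => ?_) iha iha
    constructor
    all_goals simp only [Set.mem_insert_iff, reduceCtorEq, false_or, Formula.box.injEq]
    · exact fun h => ⟨.inr (hS.and h).1, .inr (hS.and h).2⟩
    · exact fun h => ⟨.inr (hS.or h).1, .inr (hS.or h).2⟩
    · exact fun h => ⟨.inr (hS.imp h).1, .inr (hS.imp h).2⟩
    · rintro a' (rfl | h)
      exacts [.inr ha, .inr (hS.box h)]
    · exact fun h => .inr (hS.dia h)
  | dia a iha =>
    refine binary _ (fun S hS ha _ => ?_) iha iha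
    constructor
    all_goals simp only [Set.mem_insert_iff, reduceCtorEq, false_or, Formula.dia.injEq]
    · exact fun h => ⟨.inr (hS.and h).1, .inr (hS.and h).2⟩
    · exact fun h => ⟨.inr (hS.or h).1, .inr (hS.or h).2⟩
    · exact fun h => ⟨.inr (hS.imp h).1, .inr (hS.imp h).2⟩
    · exact fun h => .inr (hS.box h)
    · rintro a' (rfl | h)
      exacts [.inr ha, .inr (hS.dia h)]

theorem Set.Finite.exists_isSubformulaClosed {T : Set (Formula Var)} (hT : T.Finite) :
    ∃ S : Set (Formula Var), S.Finite ∧ IsSubformulaClosed S ∧ T ⊆ S := by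
  induction T, hT using Set.Finite.induction_on with
  | empty => exact ⟨∅, Set.finite_empty, by constructor <;> simp, le_rfl⟩
  | @insert a T _ _ ih =>
    obtain ⟨S, hSf, hS, hTS⟩ := ih
    obtain ⟨S', hSf', hS', ha⟩ := exists_finite_isSubformulaClosed a
    exact ⟨S' ∪ S, hSf'.union hSf, hS'.union hS,
      Set.insert_subset (.inl ha) (hTS.trans Set.subset_union_right)⟩

end SubformulaClosed

/-! ### Local valuations and the truth lemma -/

section LocalValuation

variable {Var : Type u}

open Formula

/-- `k` evaluates the formulas in `S` as at a world of a model in which the modal formulas take the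
values given by `g`, after all values have been cut off at the threshold `t`. -/
structure IsLocalValuation (S : Set (Formula Var)) (g : Formula Var → unitInterval)
    (t : unitInterval) (k : Formula Var → unitInterval) : Prop where
  le : ∀ {a}, a ∈ S → k a ≤ t
  bot : Formula.bot ∈ S → k Formula.bot = 0
  and : ∀ {a b}, Formula.and a b ∈ S → k (Formula.and a b) = min (k a) (k b)
  or : ∀ {a b}, Formula.or a b ∈ S → k (Formula.or a b) = max (k a) (k b)
  imp : ∀ {a b}, Formula.imp a b ∈ S →
    k (Formula.imp a b) = min (godelImp (k a) (k b)) t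
  modal : ∀ {a}, a ∈ S → IsModal a → k a = min (g a) t

/-- The conditions under which a world with local valuation `k` may have a possibility degree equal
to its threshold. -/
structure IsAccessible (S : Set (Formula Var)) (k : Formula Var → unitInterval) : Prop where
  box_le : ∀ {a}, Formula.box a ∈ S → k (Formula.box a) ≤ k a
  le_dia : ∀ {a}, Formula.dia a ∈ S → k a ≤ k (Formula.dia a)

/-- Cutting off at `t` commutes with implication, by residuation tested on `z ≤ t`. -/
theorem min_godelImp_min {x y t : unitInterval} :
    min (godelImp (min x t) (min y t)) t = min (godelImp x y) t := by
  refine eq_of_forall_le_iff fun z => ?_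
  simp only [le_min_iff, le_godelImp, and_congr_left_iff]
  intro hz
  rw [min_comm x t, ← min_assoc, min_eq_left hz]
  exact ⟨fun h => h.1, fun h => ⟨h, (min_le_left _ _).trans hz⟩⟩

/-- A frame whose worlds carry local valuations with common modal values `g`, and which has enough
worlds to approximate these, realizes the local valuations. -/
theorem min_val_eq_of_isLocalValuation {S : Set (Formula Var)} (hS : IsSubformulaClosed S)
    {g : Formula Var → unitInterval} {F : PossFrame.{v}} {t : F.W → unitInterval}
    {k : F.W → Formula Var → unitInterval} (hk : ∀ w, IsLocalValuation S g (t w) (k w))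
    (hacc : ∀ w, F.poss w = 0 ∨ F.poss w = t w ∧ IsAccessible S (k w))
    (hbox : ∀ {a}, Formula.box a ∈ S → g (Formula.box a) < 1 → ∀ ε : ℝ, 0 < ε →
      ∃ w, F.poss w = t w ∧ k w a < t w ∧ (k w a : ℝ) < g (Formula.box a) + ε)
    (hdia : ∀ {a}, Formula.dia a ∈ S → 0 < g (Formula.dia a) → ∀ ε : ℝ, 0 < ε →
      ∃ w, F.poss w = t w ∧ (g (Formula.dia a) : ℝ) - ε < k w a)
    {a : Formula Var} (ha : a ∈ S) (w : F.W) :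
    min (F.val (fun w p => k w (.var p)) a w) (t w) = k w a := by
  induction a generalizing w with
  | var p => exact min_eq_left ((hk w).le ha)
  | bot =>
    rw [(hk w).bot ha]
    exact min_eq_left unitInterval.nonneg'
  | and a b iha ihb =>
    rw [(hk w).and ha, ← iha (hS.and ha).1, ← ihb (hS.and ha).2, PossFrame.val,
      inf_inf_distrib_right]
  | or a b iha ihb =>
    rw [(hk w).or ha, ← iha (hS.or ha).1, ← ihb (hS.or ha).2, PossFrame.val,
      min_max_distrib_right]
  | imp a b iha ihb =>
    rw [(hk w).imp ha, ← iha (hS.imp ha).1, ← ihb (hS.imp ha).2, PossFrame.val, min_godelImp_min]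
  | box a iha =>
    rw [(hk w).modal ha (.box a)]
    congr 1
    replace iha := iha (hS.box ha)
    refine le_antisymm ?_ ?_
    · by_contra! hcon
      -- With ε the supposed excess, `h3` puts `k w' a` below the value of □a; `h2` ensures that the
      -- cut-off does not hide this.
      obtain ⟨w', h1, h2, h3⟩ := hbox ha (hcon.trans_le unitInterval.le_one') _
        (sub_pos.2 (Subtype.coe_lt_coe.2 hcon))
      rw [add_sub_cancel, Subtype.coe_lt_coe] at h3
      have h4 := (F.le_val_box _).1 (le_refl (F.val (fun w p => k w (.var p)) (.box a) w)) w'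
      rw [h1] at h4
      have h5 := (le_min h4 (min_le_right _ _)).trans_eq (iha w')
      rcases min_le_iff.1 h5 with h6 | h6
      · exact absurd h6 (not_le.2 h3)
      · exact absurd h6 (not_le.2 h2)
    · rw [F.le_val_box]
      intro w'
      rcases hacc w' with h0 | ⟨h1, h2⟩
      · rw [h0]
        exact (min_le_right _ _).trans unitInterval.nonneg'
      · rw [h1, ← (hk w').modal ha (.box a)]
        exact ((h2.box_le ha).trans_eq (iha w').symm).trans (min_le_left _ _)
  | dia a iha =>
    rw [(hk w).modal ha (.dia a)]
    congr 1
    replace iha := iha (hS.dia ha)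
    refine le_antisymm ?_ ?_
    · rw [F.val_dia_le]
      intro w'
      rcases hacc w' with h0 | ⟨h1, h2⟩
      · rw [h0]
        exact (min_le_left _ _).trans unitInterval.nonneg'
      · rw [h1, min_comm, iha w']
        refine (h2.le_dia ha).trans ?_
        rw [(hk w').modal ha (.dia a)]
        exact min_le_left _ _
    · by_contra! hcon
      obtain ⟨w', h1, h2⟩ := hdia ha (unitInterval.nonneg'.trans_lt hcon) _
        (sub_pos.2 (Subtype.coe_lt_coe.2 hcon))
      rw [sub_sub_cancel, Subtype.coe_lt_coe, ← iha w', min_comm, ← h1] at h2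
      exact absurd ((F.val_dia_le _).1 le_rfl w') (not_le.2 h2)

/-- An order embedding of the truth values of a prime theory is a local valuation. -/
theorem IsPrimeTheory.isLocalValuation {X S : Set (Formula Var)} (hX : IsPrimeTheory X)
    (hS : IsSubformulaClosed S) (htop : Formula.top ∈ S) {g k : Formula Var → unitInterval}
    {t : unitInterval} (hk : ∀ a ∈ S, ∀ b ∈ S, k a ≤ k b ↔ Formula.imp a b ∈ X)
    (hmodal : ∀ a ∈ S, IsModal a → k a = min (g a) t) (hbot : k Formula.bot = 0)
    (hkt : k Formula.top = t) : IsLocalValuation S g t k where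
  le ha := by
    rw [← hkt, hk _ ha _ htop]
    exact hX.mem_of_derives (.weaken .top)
  bot _ := hbot
  and {a b} h := by
    obtain ⟨ha, hb⟩ := hS.and h
    refine le_antisymm (le_min ?_ ?_) ?_
    · exact (hk _ h _ ha).2 (hX.mem_of_derives (.godel (.and_left _ _)))
    · exact (hk _ h _ hb).2 (hX.mem_of_derives (.godel (.and_right _ _)))
    · rcases hX.imp_total a b with hab | hab
      · refine (min_le_left _ _).trans ((hk _ ha _ h).2 (hX.mem_of_derives (.deduction ?_)))
        exact .mp (.mp (.godel (.and_intro _ _)) .hyp_insert)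
          (.mp (.insert_of (.hyp hab)) .hyp_insert)
      · refine (min_le_right _ _).trans ((hk _ hb _ h).2 (hX.mem_of_derives (.deduction ?_)))
        exact .mp (.mp (.godel (.and_intro _ _)) (.mp (.insert_of (.hyp hab)) .hyp_insert))
          .hyp_insert
  or {a b} h := by
    obtain ⟨ha, hb⟩ := hS.or h
    refine le_antisymm ?_ (max_le ?_ ?_)
    · rcases hX.imp_total a b with hab | hab
      · refine ((hk _ h _ hb).2 (hX.mem_of_derives ?_)).trans (le_max_right _ _)
        exact .mp (.mp (.godel (.or_elim _ _ _)) (.hyp hab)) (.imp_self _)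
      · refine ((hk _ h _ ha).2 (hX.mem_of_derives ?_)).trans (le_max_left _ _)
        exact .mp (.mp (.godel (.or_elim _ _ _)) (.imp_self _)) (.hyp hab)
    · exact (hk _ ha _ h).2 (hX.mem_of_derives (.godel (.or_left _ _)))
    · exact (hk _ hb _ h).2 (hX.mem_of_derives (.godel (.or_right _ _)))
  imp {a b} h := by
    obtain ⟨ha, hb⟩ := hS.imp h
    have hle : k (Formula.imp a b) ≤ t := by
      rw [← hkt, hk _ h _ htop]
      exact hX.mem_of_derives (.weaken .top)
    by_cases hab : Formula.imp a b ∈ X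
    · rw [godelImp_eq_one.2 ((hk _ ha _ hb).2 hab), min_eq_right unitInterval.le_one']
      refine le_antisymm hle ?_
      rw [← hkt, hk _ htop _ h]
      exact hX.imp_of_mem hab
    · have hab' : ¬ k a ≤ k b := fun hle => hab ((hk _ ha _ hb).1 hle)
      -- An implication outside `X` is equivalent in `X` to its conclusion.
      have h1 : k (Formula.imp a b) = k b := le_antisymm ((hk _ h _ hb).2 (hX.imp_imp_self hab))
        ((hk _ hb _ h).2 (hX.mem_of_derives (.godel (.imp_weaken _ _))))
      rw [godelImp, if_neg hab', ← h1, min_eq_left hle]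
  modal ha hm := hmodal _ ha hm

end LocalValuation

/-! ### Witness worlds for □ and ◇ -/

section Witnesses

variable {Var : Type u}

open Formula

/-- The modal formulas in `V` and the formula `γ`, with the reflexivity principles for `□` and
`◇`. -/
def reflexiveModalTheory (V : Set (Formula Var)) (γ : Formula Var) : Set (Formula Var) :=
  {a | (IsModal a ∧ a ∈ V) ∨ a = γ ∨ ∃ b, a = imp (box b) b ∨ a = imp b (dia b)}

variable {V : Set (Formula Var)} {γ : Formula Var}

theorem IsPrimeTheory.imp_box_mem (hV : IsPrimeTheory V) (hγ : IsModal γ) {φ : Formula Var}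
    (h : KD45GDerives (reflexiveModalTheory V γ) φ) : imp γ (box φ) ∈ V := by
  refine hV.mem_of_derives (.deduction (h.box_of_forall ?_))
  rintro p (⟨hp, hpV⟩ | rfl | ⟨b, rfl | rfl⟩)
  · exact .mp hp.derives.1 (.insert_of (.hyp hpV))
  · exact .mp hγ.derives.1 .hyp_insert
  · exact .box_box_imp b
  · exact .box_imp_dia b

/-- `V` is a prime theory whose truth values on the finite, subformula closed set `S` are embedded
into the unit interval by `g`. -/
structure IsFiniteValuation (S V : Set (Formula Var)) (g : Formula Var → unitInterval) : Prop where
  finite : S.Finite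
  closed : IsSubformulaClosed S
  top_mem : Formula.top ∈ S
  prime : IsPrimeTheory V
  le_iff : ∀ a ∈ S, ∀ b ∈ S, g a ≤ g b ↔ imp a b ∈ V
  bot : g Formula.bot = 0
  top : g Formula.top = 1

variable {S : Set (Formula Var)} {g : Formula Var → unitInterval}

theorem IsFiniteValuation.bot_mem (h : IsFiniteValuation S V g) : Formula.bot ∈ S :=
  (h.closed.imp h.top_mem).1

theorem IsFiniteValuation.isLocalValuation (h : IsFiniteValuation S V g) :
    IsLocalValuation S g 1 g :=
  h.prime.isLocalValuation h.closed h.top_mem h.le_iff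
    (fun _ _ _ => (min_eq_left unitInterval.le_one').symm) h.bot h.top

/-- The map ⊥ ↦ 0, ⊤ ↦ 1 is extended to `S`; consistency of `V` keeps the two ends distinct. -/
theorem exists_isFiniteValuation (hf : S.Finite) (hS : IsSubformulaClosed S)
    (htop : Formula.top ∈ S) (hV : IsPrimeTheory V) (hbot : Formula.bot ∉ V) :
    ∃ g, IsFiniteValuation S V g := by
  have hne : (Formula.top : Formula Var) ≠ Formula.bot := by simp [Formula.top, Formula.neg]
  classical
  obtain ⟨g, h1, h2, -⟩ := exists_unitInterval_order_extension
    (le := fun a b => imp a b ∈ V) (M := {Formula.top, Formula.bot})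
    (g := fun a => if a = Formula.bot then 0 else 1) hV.imp_total
    hV.imp_trans hf (by
      rintro a (rfl | rfl)
      exacts [htop, (hS.imp htop).1])
    (by
      rintro a (rfl | rfl) b (rfl | rfl)
      · simpa [hne] using hV.imp_of_mem (hV.mem_of_derives .top)
      · simpa [hne, hV.top_imp_mem_iff] using hbot
      · simpa [hne] using hV.mem_of_derives (.godel (.bot_elim _))
      · simpa [hne] using hV.mem_of_derives (.godel (.bot_elim _)))
    (fun a _ => ⟨Formula.bot, by simp, hV.mem_of_derives (.godel (.bot_elim _))⟩)
    (fun a _ => ⟨Formula.top, by simp, hV.imp_of_mem (hV.mem_of_derives .top)⟩)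
    le_rfl one_pos le_rfl
  exact ⟨g, hf, hS, htop, hV, h2, by simpa using h1 Formula.bot (by simp),
    by simpa [hne] using h1 Formula.top (by simp)⟩

variable {W : Set (Formula Var)}

/-- A prime theory `W` that extends `reflexiveModalTheory V γ`, and contains no modal formula of
`S` with a value below that of `γ`, yields an accessible local valuation with the value of `γ` as
its threshold. -/
theorem IsFiniteValuation.exists_isAccessible (h : IsFiniteValuation S V g) (hW : IsPrimeTheory W)
    (hγS : γ ∈ S) (hγ : IsModal γ) (hVW : reflexiveModalTheory V γ ⊆ W)
    (hlt : ∀ m ∈ S, IsModal m → g m < g γ → m ∉ W) {p q : ℝ} (hp : 0 ≤ p) (hpq : p < q)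
    (hq : q ≤ 1) :
    ∃ k, IsLocalValuation S g (g γ) k ∧ IsAccessible S k ∧
      (∀ a ∈ S, ∀ b ∈ S, k a ≤ k b ↔ imp a b ∈ W) ∧ k Formula.top = g γ ∧
      ∀ a ∈ S, (∃ m ∈ S, IsModal m ∧ imp m a ∈ W ∧ (k a : ℝ) ≤ g m + q) ∧
        ∃ m ∈ S, IsModal m ∧ imp a m ∈ W ∧
          ((min (g m) (g γ) : unitInterval) : ℝ) - (1 - p) ≤ k a := by
  have hmodal : ∀ {c}, IsModal c → c ∈ V → c ∈ W := fun hc hcV => hVW (.inl ⟨hc, hcV⟩)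
  have hγW : γ ∈ W := hVW (.inr (.inl rfl))
  have hg : ∀ a ∈ {a ∈ S | IsModal a}, ∀ b ∈ {a ∈ S | IsModal a},
      min (g a) (g γ) ≤ min (g b) (g γ) ↔ imp a b ∈ W := by
    rintro a ⟨ha, ham⟩ b ⟨hb, hbm⟩
    constructor
    · intro hab
      rcases le_or_gt (g γ) (g b) with hb' | hb'
      · exact hW.imp_of_mem (hW.mp (hmodal (.imp hγ hbm) ((h.le_iff _ hγS _ hb).1 hb')) hγW)
      · have : g a ≤ g b := by
          rw [min_eq_left hb'.le] at hab
          exact (min_le_iff.1 hab).resolve_right (not_le.2 hb')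
        exact hmodal (.imp ham hbm) ((h.le_iff _ ha _ hb).1 this)
    · intro hab
      by_contra! hcon
      have hb' : g b < g γ := by
        by_contra! hb'
        rw [min_eq_right hb'] at hcon
        exact absurd hcon (not_lt.2 (min_le_right _ _))
      have hba : g b < g a := by
        rw [min_eq_left hb'.le] at hcon
        exact hcon.trans_le (min_le_left _ _)
      have habV : imp a b ∉ V := fun hmem => absurd ((h.le_iff _ ha _ hb).2 hmem) (not_le.2 hba)
      -- (a → b) → b is modal and lies in `V`, hence in `W`; so a → b in `W` would force b into `W`,
      -- against `hlt`.
      exact hlt b hb hbm hb' (hW.mp (hmodal (.imp (.imp ham hbm) hbm)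
        (h.prime.imp_imp_self habV)) hab)
  have hbotW : ∀ a, imp Formula.bot a ∈ W := fun a => hW.mem_of_derives (.godel (.bot_elim _))
  have htopW : ∀ a, imp a Formula.top ∈ W := fun a => hW.mem_of_derives (.weaken .top)
  obtain ⟨k, h1, h2, h3⟩ := exists_unitInterval_order_extension
    (le := fun a b => imp a b ∈ W) (M := {a ∈ S | IsModal a})
    (g := fun a => min (g a) (g γ)) hW.imp_total hW.imp_trans h.finite
    (Set.sep_subset _ _) hg (fun a _ => ⟨_, ⟨h.bot_mem, .bot⟩, hbotW a⟩)
    (fun a _ => ⟨_, ⟨h.top_mem, .top⟩, htopW a⟩) hp hpq hq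
  have hkbot : k Formula.bot = 0 := by
    rw [h1 _ ⟨h.bot_mem, .bot⟩, h.bot]
    exact min_eq_left unitInterval.nonneg'
  have hktop : k Formula.top = g γ := by
    rw [h1 _ ⟨h.top_mem, .top⟩, h.top]
    exact min_eq_right unitInterval.le_one'
  refine ⟨k, hW.isLocalValuation h.closed h.top_mem h2 (fun a ha hm => h1 a ⟨ha, hm⟩) hkbot hktop,
    ⟨fun {a} ha => ?_, fun {a} ha => ?_⟩, h2, hktop, fun a ha => ?_⟩
  · exact (h2 _ ha _ (h.closed.box ha)).2 (hVW (.inr (.inr ⟨a, .inl rfl⟩)))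
  · exact (h2 _ (h.closed.dia ha) _ ha).2 (hVW (.inr (.inr ⟨a, .inr rfl⟩)))
  · obtain ⟨⟨m, hm, h4, h5⟩, m', hm', h6, h7⟩ := h3 a ha
    have h8 : ((min (g m) (g γ) : unitInterval) : ℝ) ≤ g m := min_le_left (g m) (g γ)
    exact ⟨⟨m, hm.1, hm.2, h4, by linarith⟩, m', hm'.1, hm'.2, h6, h7⟩

theorem IsFiniteValuation.exists_box_witness (h : IsFiniteValuation S V g) {a : Formula Var}
    (ha : box a ∈ S) (hlt : g (box a) < 1) {ε : ℝ} (hε : 0 < ε) :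
    ∃ t k, IsLocalValuation S g t k ∧ IsAccessible S k ∧ k a < t ∧
      (k a : ℝ) < g (box a) + ε := by
  -- The threshold is the least modal value above that of □a, so a modal formula of `S` below it is
  -- already at most □a.
  obtain ⟨γ, ⟨⟨hγS, hγ⟩, hγlt⟩, hγmin⟩ := Set.exists_min_image
    {m | (m ∈ S ∧ IsModal m) ∧ g (box a) < g m} g (h.finite.subset fun m hm => hm.1.1)
    ⟨Formula.top, ⟨h.top_mem, .top⟩, by rwa [h.top]⟩
  have hder : ¬ KD45GDerives (reflexiveModalTheory V γ) a := fun hd =>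
    absurd ((h.le_iff _ hγS _ ha).2 (h.prime.imp_box_mem hγ hd)) (not_le.2 hγlt)
  obtain ⟨W, hVW, hW, haW⟩ := exists_isPrimeTheory hder
  have hle : ∀ m ∈ S, IsModal m → g m < g γ → g m ≤ g (box a) := fun m hm hmm hmlt => by
    by_contra! hcon
    exact absurd (hγmin m ⟨⟨hm, hmm⟩, hcon⟩) (not_le.2 hmlt)
  have hnot : ∀ m ∈ S, IsModal m → g m < g γ → m ∉ W := fun m hm hmm hmlt hmW => by
    have h1 : imp m (box a) ∈ W :=
      hVW (.inl ⟨.imp hmm (.box a), (h.le_iff _ hm _ ha).1 (hle m hm hmm hmlt)⟩)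
    exact haW (hW.mp (hVW (.inr (.inr ⟨a, .inl rfl⟩))) (hW.mp h1 hmW))
  -- With `p = 0` and `q ≤ ε / 2`, non-modal values lie close to the lower ends of their gaps.
  obtain ⟨k, h1, h2, h3, h4, h5⟩ := h.exists_isAccessible hW hγS hγ hVW hnot le_rfl
    (lt_min one_pos (half_pos hε)) (min_le_left 1 (ε / 2))
  have haS := h.closed.box ha
  have hka : k a < g γ := by
    by_contra! hcon
    rw [← h4, h3 _ h.top_mem _ haS, hW.top_imp_mem_iff] at hcon
    exact haW hcon
  refine ⟨g γ, k, h1, h2, hka, ?_⟩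
  obtain ⟨⟨m, hm, hmm, h6, h7⟩, -⟩ := h5 a haS
  have hmlt : g m < g γ := by
    by_contra! hcon
    have := ((h3 _ hm _ haS).2 h6).trans_lt hka
    rw [h1.modal hm hmm, min_eq_right hcon] at this
    exact lt_irrefl _ this
  have h8 : (g m : ℝ) ≤ g (box a) := hle m hm hmm hmlt
  have h10 := min_le_right (1 : ℝ) (ε / 2)
  linarith

theorem IsFiniteValuation.exists_dia_witness (h : IsFiniteValuation S V g) {a : Formula Var}
    (ha : dia a ∈ S) (hpos : 0 < g (dia a)) {ε : ℝ} (hε : 0 < ε) :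
    ∃ k, IsLocalValuation S g (g (dia a)) k ∧ IsAccessible S k ∧ (g (dia a) : ℝ) - ε < k a := by
  -- δ is the modal formula just below ◇a. A derivation of a → δ would give ◇a → ◇δ, hence ◇a → δ,
  -- in `V`.
  obtain ⟨δ, ⟨⟨hδS, hδ⟩, hδlt⟩, hδmax⟩ := Set.exists_max_image
    {m | (m ∈ S ∧ IsModal m) ∧ g m < g (dia a)} g (h.finite.subset fun m hm => hm.1.1)
    ⟨Formula.bot, ⟨h.bot_mem, .bot⟩, by rwa [h.bot]⟩
  have hder : ¬ KD45GDerives (reflexiveModalTheory V (dia a)) (imp a δ) := fun hd => by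
    refine absurd ((h.le_iff _ ha _ hδS).2 (h.prime.mem_of_derives (.deduction ?_)))
      (not_le.2 hδlt)
    have h1 := KD45GDerives.hyp (h.prime.imp_box_mem (.dia a) hd)
    exact .mp hδ.derives.2 (.mp (.dia_mono (.mp h1.insert_of .hyp_insert)) .hyp_insert)
  obtain ⟨W, hVW, hW, haW⟩ := exists_isPrimeTheory hder
  have hmem : ∀ m ∈ S, IsModal m → g m < g (dia a) → imp m δ ∈ W := fun m hm hmm hmlt =>
    hVW (.inl ⟨.imp hmm hδ, (h.le_iff _ hm _ hδS).1 (hδmax m ⟨⟨hm, hmm⟩, hmlt⟩)⟩)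
  have hnot : ∀ m ∈ S, IsModal m → g m < g (dia a) → m ∉ W := fun m hm hmm hmlt hmW =>
    haW (hW.imp_of_mem (hW.mp (hmem m hm hmm hmlt) hmW))
  -- With `q = 1` and `p ≥ 1 - ε / 2`, values lie close to the upper ends of their gaps.
  obtain ⟨k, h1, h2, h3, h4, h5⟩ := h.exists_isAccessible hW ha (.dia a) hVW hnot
    (le_max_left 0 (1 - ε / 2)) (max_lt one_pos (by linarith)) le_rfl
  refine ⟨k, h1, h2, ?_⟩
  obtain ⟨-, m, hm, hmm, h6, h7⟩ := h5 a (h.closed.dia ha)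
  have hmge : g (dia a) ≤ g m := by
    by_contra! hcon
    exact haW (hW.imp_trans h6 (hmem m hm hmm hcon))
  rw [min_eq_right hmge] at h7
  have h8 := le_max_right 0 (1 - ε / 2)
  linarith

end Witnesses

/-! ### The model and completeness -/

section Completeness

variable {Var : Type u}

open Formula

theorem Formula.countable [Countable Var] : Countable (Formula Var) := by
  obtain ⟨f, hf⟩ := exists_injective_nat Var
  let code : Formula Var → ℕ := Formula.rec (fun p => Nat.pair 0 (f p)) (Nat.pair 1 0)
    (fun _ _ m n => Nat.pair 2 (Nat.pair m n)) (fun _ _ m n => Nat.pair 3 (Nat.pair m n))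
    (fun _ _ m n => Nat.pair 4 (Nat.pair m n)) (fun _ m => Nat.pair 5 m) (fun _ m => Nat.pair 6 m)
  refine ⟨code, fun a => ?_⟩
  induction a with
  | var p => intro b h; cases b <;> simp_all [code, Nat.pair_eq_pair, hf.eq_iff]
  | bot => intro b h; cases b <;> simp_all [code, Nat.pair_eq_pair]
  | and a a' ih ih' =>
    intro b h
    cases b <;> simp only [code, Nat.pair_eq_pair] at h <;> try omega
    exact congrArg₂ _ (ih h.2.1) (ih' h.2.2)
  | or a a' ih ih' =>
    intro b h
    cases b <;> simp only [code, Nat.pair_eq_pair] at h <;> try omega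
    exact congrArg₂ _ (ih h.2.1) (ih' h.2.2)
  | imp a a' ih ih' =>
    intro b h
    cases b <;> simp only [code, Nat.pair_eq_pair] at h <;> try omega
    exact congrArg₂ _ (ih h.2.1) (ih' h.2.2)
  | box a ih =>
    intro b h
    cases b <;> simp only [code, Nat.pair_eq_pair] at h <;> try omega
    exact congrArg _ (ih h.2)
  | dia a ih =>
    intro b h
    cases b <;> simp only [code, Nat.pair_eq_pair] at h <;> try omega
    exact congrArg _ (ih h.2)

/-- The truth values of a prime theory on a finite set of formulas are realized at a world of a
possibilistic model. -/
theorem IsFiniteValuation.exists_val_eq [Countable Var] {S V : Set (Formula Var)}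
    {g : Formula Var → unitInterval} (h : IsFiniteValuation S V g)
    (hD : dia Formula.top ∈ S) :
    ∃ (F : PossFrame.{v}) (e : F.W → Var → unitInterval) (w : F.W), ∀ a ∈ S, F.val e a w = g a := by
  -- Countability makes the type of worlds small, so that the frame can be placed in any universe.
  have : Countable (Formula Var) := Formula.countable
  let World := {d : unitInterval × unitInterval × (Formula Var → unitInterval) //
    IsLocalValuation S g d.1 d.2.2 ∧ (d.2.1 = 0 ∨ d.2.1 = d.1 ∧ IsAccessible S d.2.2)}
  have : Small.{v} (Formula Var → unitInterval) := inferInstance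
  have : Small.{v} World := inferInstance
  let data : Shrink.{v} World → World := (equivShrink World).symm
  have hsurj : ∀ (t : unitInterval) (k : Formula Var → unitInterval), IsLocalValuation S g t k →
      IsAccessible S k → ∃ w, (data w).1 = (t, t, k) := by
    intro t k h1 h2
    obtain ⟨w, hw⟩ := (equivShrink World).symm.surjective ⟨(t, t, k), h1, .inr ⟨rfl, h2⟩⟩
    exact ⟨w, congrArg Subtype.val hw⟩
  -- The root has threshold 1, so nothing is cut off, and possibility 0, so `g` need not satisfy □a
  -- ≤ a ≤ ◇a.
  obtain ⟨root, hroot⟩ : ∃ w, (data w).1 = (1, 0, g) := by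
    obtain ⟨w, hw⟩ := (equivShrink World).symm.surjective
      ⟨(1, 0, g), h.isLocalValuation, .inl rfl⟩
    exact ⟨w, congrArg Subtype.val hw⟩
  -- Axiom `D` yields normalization: the witness for ◇⊤ has threshold, hence possibility, 1.
  have hD1 : g (dia Formula.top) = 1 := by
    rw [← unitInterval_one_le_iff, ← h.top, h.le_iff _ h.top_mem _ hD]
    exact h.prime.mem_of_derives (.weaken (.ax .D))
  obtain ⟨k, hk1, hk2, -⟩ := h.exists_dia_witness hD (by rw [hD1]; exact zero_lt_one) one_pos
  obtain ⟨w₁, hw₁⟩ := hsurj _ k hk1 hk2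
  let F : PossFrame.{v} :=
    { W := Shrink.{v} World
      nonempty := ⟨root⟩
      poss := fun w => (data w).1.2.1
      normalized := by
        rw [← unitInterval_one_le_iff]
        refine le_trans ?_ (le_iSup _ w₁)
        rw [hw₁, hD1] }
  have key := fun {a : Formula Var} (ha : a ∈ S) => min_val_eq_of_isLocalValuation (F := F)
    h.closed (t := fun w => (data w).1.1) (k := fun w => (data w).1.2.2) (fun w => (data w).2.1)
    (fun w => (data w).2.2)
    (fun {a} ha hlt ε hε => by
      obtain ⟨t, k, h1, h2, h3, h4⟩ := h.exists_box_witness ha hlt hε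
      obtain ⟨w, hw⟩ := hsurj t k h1 h2
      exact ⟨w, by simp only [F, hw], by simpa only [hw] using h3, by simpa only [hw] using h4⟩)
    (fun {a} ha hpos ε hε => by
      obtain ⟨k, h1, h2, h3⟩ := h.exists_dia_witness ha hpos hε
      obtain ⟨w, hw⟩ := hsurj _ k h1 h2
      exact ⟨w, by simp only [F, hw], by simpa only [hw] using h3⟩) ha root
  refine ⟨F, fun w p => (data w).1.2.2 (.var p), root, fun a ha => ?_⟩
  have h1 := key ha
  simp only [hroot] at h1
  rwa [min_eq_left unitInterval.le_one'] at h1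

theorem PossEntails.derives [Countable Var] {T : Set (Formula Var)} {φ : Formula Var}
    (hT : T.Finite) (h : PossEntails.{u, v} T φ) : KD45GDerives T φ := by
  by_contra hcon
  obtain ⟨V, hTV, hV, hφ⟩ := exists_isPrimeTheory hcon
  -- ◇⊤ is included for normalization; it also brings ⊤ and ⊥ into `S`.
  obtain ⟨S, hSf, hS, hTS⟩ := ((hT.insert φ).insert (dia Formula.top)).exists_isSubformulaClosed
  have hD : dia Formula.top ∈ S := hTS (Set.mem_insert _ _)
  have hφS : φ ∈ S := hTS (.inr (Set.mem_insert _ _))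
  obtain ⟨g, hg⟩ := exists_isFiniteValuation hSf hS (hS.dia hD) hV
    fun hbot => hφ (hV.mem_of_derives (.bot_elim (.hyp hbot)))
  have hone : ∀ a ∈ S, g a = 1 ↔ a ∈ V := fun a ha => by
    rw [← unitInterval_one_le_iff, ← hg.top, hg.le_iff _ hg.top_mem _ ha, hV.top_imp_mem_iff]
  obtain ⟨F, e, w, hval⟩ := hg.exists_val_eq.{u, v} hD
  refine hφ ((hone φ hφS).1 ?_)
  rw [← hval φ hφS]
  refine h F e w fun ψ hψ => ?_
  have hψS : ψ ∈ S := hTS (.inr (.inr hψ))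
  rw [hval ψ hψS]
  exact (hone ψ hψS).2 (hTV hψ)

end Completeness

theorem theorem1 {Var : Type u} [Countable Var] :
    (∀ (T : Set (Formula Var)) (φ : Formula Var), T.Finite →
      (PossEntails.{u, v} T φ ↔ KD45GDerives T φ)) ∧
    KD45GTheorems Var = PossValidities.{u, v} Var := by
  refine ⟨fun T φ hT => ⟨PossEntails.derives hT, KD45GDerives.sound⟩, Set.ext fun φ => ⟨?_, ?_⟩⟩
  · exact fun h F e w => KD45GDerives.sound h F e w (by simp)
  · exact fun h => PossEntails.derives.{u, v} Set.finite_empty fun F e w _ => h F e w
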